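/- Let $k\geqslant 2$ be an integer. An integer-valued sequence $\{f(n)\}_{n\geqslant 0}$ is called $k$-regular if there are an integer $D\geqslant 1$, matrices $A_0,\dots,A_{k-1}\in\mathbb{Z}^{D\times D}$ and vectors $v,w\in\mathbb{Z}^D$ such that $f(n)=w^T A_{i_0}\cdots A_{i_s}v$ for all $n\geqslant 0$, where $i_s\cdots i_0$ is the base-$k$ expansion of $n$. For a nonnegative $k$-regular sequence $f$ that is not identically zero, let $\alpha_f$ denote the (unique) real number $\alpha_f\geqslant 1$ for which there is an integer $m_f\geqslant 0$ such that, as $N\to\infty$, $$\sum_{n\leqslant N} f(n)\asymp N^{\log_k\alpha_f}(\log N)^{m_f},$$ that is, the quotient of the two sides lies between two positive constants for all large $N$. Theorem. Let $f_1,\dots,f_d$ be nonnegative integer-valued $k$-regular sequences with generating functions $F_i(z)=\sum_{n\geqslant 0}f_i(n)z^n$, and let $\mathcal{M}$ be the set of functions meromorphic on $\mathbb{C}$. Regard the $F_i$ and the elements of $\mathcal{M}$ (through their Laurent expansions at $0$) as elements of $\mathbb{C}((z))$. If the numbers $k,\alpha_{f_1},\dots,\alpha_{f_d}$ are multiplicatively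 independent, that is, if $k^{e_0}\alpha_{f_1}^{e_1}\cdots\alpha_{f_d}^{e_d}=1$ with integers $e_0,\dots,e_d$ only for $e_0=\dots=e_d=0$, then $$\operatorname{trdeg}_{\mathbb{C}(z)(\mathcal{M})}\mathbb{C}(z)(\mathcal{M})(F_1(z),\dots,F_d(z))=d,$$ that is, $F_1,\dots,F_d$ are algebraically independent over $\mathbb{C}(z)(\mathcal{M})$. In particular, $F_1,\dots,F_d$ are algebraically independent over $\mathbb{C}(z)$. -/

import Mathlib

open scoped Topology RatFunc

/-- An integer-valued sequence `f` is `k`-regular (`2 ≤ k`): for some `D ≥ 1` there are integer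
`D × D` matrices `A 0, …, A (k - 1)` and vectors `v, w ∈ ℤ ^ D` with
`f n = wᵀ A_{i_0} ⋯ A_{i_s} v` for all `n`, where `i_s ⋯ i_0` is the base-`k` expansion of `n`.
`Nat.digits k n` lists the digits beginning with the least significant one `i_0`; all its entries
are smaller than `k`, so the matrices `A j` with `k ≤ j` are never used. -/
def IsRegularSeq (k : ℕ) (f : ℕ → ℤ) : Prop :=
  ∃ (D : ℕ) (A : ℕ → Matrix (Fin D) (Fin D) ℤ) (v w : Fin D → ℤ), 0 < D ∧
    ∀ n : ℕ, f n = w ⬝ᵥ Matrix.mulVec ((Nat.digits k n).map A).prod v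

/-- `α` is the growth constant of `f` in base `k`: it is a real number `α ≥ 1` such that, for some
integer `m ≥ 0`, the sum `∑_{n ≤ N} f n` lies between two positive constant multiples of
`N ^ (log_k α) * (log N) ^ m` for all large `N`. Such an `α` is determined by `f` and `k`. -/
def IsGrowthConstant (k : ℕ) (f : ℕ → ℤ) (α : ℝ) : Prop :=
  1 ≤ α ∧ ∃ m : ℕ,
    (fun N : ℕ => ∑ n ∈ Finset.range (N + 1), (f n : ℝ)) =Θ[Filter.atTop]
      (fun N : ℕ => (N : ℝ) ^ Real.logb (k : ℝ) α * Real.log (N : ℝ) ^ m)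

/-- Multiplicative independence of a finite family of nonzero real numbers: the only product of
integer powers of its members that equals `1` is the one with all exponents zero. -/
def MultiplicativelyIndependent {n : ℕ} (x : Fin n → ℝ) : Prop :=
  ∀ e : Fin n → ℤ, ∏ i, x i ^ e i = 1 → ∀ i, e i = 0

/-- The formal Laurent series `L` is the Laurent expansion at `0` of the function `g`: it converges
to `g z` for all `z ≠ 0` close to `0`. -/
def IsLaurentExpansion (L : LaurentSeries ℂ) (g : ℂ → ℂ) : Prop :=
  ∀ᶠ z in 𝓝[≠] (0 : ℂ), HasSum (fun n : ℤ => L.coeff n * z ^ n) (g z)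

/-- The set `𝓜` of functions that are meromorphic on the whole complex plane, each of them
identified with its Laurent expansion at `0`. -/
def meromorphicFunctions : Set (LaurentSeries ℂ) :=
  {L | ∃ g : ℂ → ℂ, Meromorphic g ∧ IsLaurentExpansion L g}

/-- The field `ℂ(z)(𝓜)`, inside the field of formal Laurent series in `z`. -/
noncomputable def meromorphicField : IntermediateField (RatFunc ℂ) (LaurentSeries ℂ) :=
  IntermediateField.adjoin (RatFunc ℂ) meromorphicFunctions

/-- The generating function `∑ f n z ^ n` of an integer sequence, as a formal Laurent series. -/
noncomputable def generatingFunction (f : ℕ → ℤ) : LaurentSeries ℂ :=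
  ((PowerSeries.mk fun n => (f n : ℂ) : PowerSeries ℂ) : LaurentSeries ℂ)

/-!
The proof compares sizes on the real axis as `x → 1⁻`. If `∑_{n ≤ N} f n` is of the size
`N ^ β * (log N) ^ m` with `β = log_k α`, then the generating function `F` converges on the unit disc
and `F x = (1 - x) ^ (-β + o(1))` (`IsGrowthConstant.hasLogOrder`): the upper bound comes from
summation by parts, the lower bound from the first `⌈1 / (1 - x)⌉` terms. A nonzero function that is
meromorphic on `ℂ` has the size `(1 - x) ^ n` for some integer `n`
(`MeromorphicAt.exists_hasLogOrder`).

The field `ℂ(z)(𝓜)` contains nothing but expansions of meromorphic functions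
(`meromorphicField_subset_meromorphicFunctions`). An algebraic relation between the `F i` over it is
thus a relation `∑ j, g j * ∏ i, F i ^ j i = 0` with meromorphic `g j`, first near `0` and then, by
the identity theorem, on the unit disc away from the poles. Its terms are of the size
`(1 - x) ^ (n j - ∑ i, j i * log_k (α i))` with integers `n j`, and these exponents are pairwise
distinct, because two equal ones would give a multiplicative relation between `k` and the `α i`
(`MultiplicativelyIndependent.eq_zero_of_logb`). So the term of least exponent dominates all the
others near `1`, and the sum cannot vanish (`HasLogOrder.sum_ne_zero`).
-/

/-! ### Laurent expansions at the origin -/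

/-- The product of two (absolutely) convergent series over `ℤ`, summed along the fibres of the total
degree. -/
lemma hasSum_mul_of_fiber {a b c : ℤ → ℂ} {x y : ℂ} (ha : HasSum a x) (hb : HasSum b y)
    (hc : ∀ n, HasSum (((fun p : ℤ × ℤ => p.1 + p.2) ⁻¹' {n}).indicator
      fun p : ℤ × ℤ => a p.1 * b p.2) (c n)) : HasSum c (x * y) := by
  have hprod := ha.mul hb (summable_mul_of_summable_norm ha.summable.norm hb.summable.norm)
  have hcoeff : c = _ := funext fun n => (hasSum_subtype_iff_indicator.2 (hc n)).tsum_eq.symm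
  rw [hcoeff]
  exact hprod.tsum_fiberwise fun p : ℤ × ℤ => p.1 + p.2

lemma hasSum_indicator_fiber (L L' : LaurentSeries ℂ) {z : ℂ} (hz0 : z ≠ 0) (n : ℤ) :
    HasSum (((fun p : ℤ × ℤ => p.1 + p.2) ⁻¹' {n}).indicator
      fun p : ℤ × ℤ => L.coeff p.1 * z ^ p.1 * (L'.coeff p.2 * z ^ p.2))
      ((L * L').coeff n * z ^ n) := by
  rw [HahnSeries.coeff_mul, Finset.sum_mul]
  have hfib (p : ℤ × ℤ) (hpn : p.1 + p.2 = n) : L.coeff p.1 * L'.coeff p.2 * z ^ n =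
      ((fun p : ℤ × ℤ => p.1 + p.2) ⁻¹' {n}).indicator
        (fun p : ℤ × ℤ => L.coeff p.1 * z ^ p.1 * (L'.coeff p.2 * z ^ p.2)) p := by
    rw [Set.indicator_of_mem (show p ∈ (fun p : ℤ × ℤ => p.1 + p.2) ⁻¹' {n} from hpn), ← hpn,
      zpow_add₀ hz0]
    ring
  rw [Finset.sum_congr rfl fun p hp => hfib p (Finset.mem_antidiagonal.1 hp).2.2]
  -- Pairs of total degree `n` outside the antidiagonal have a vanishing coefficient.
  refine hasSum_sum_of_ne_finset_zero fun p hp => ?_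
  by_cases hpn : p ∈ (fun p : ℤ × ℤ => p.1 + p.2) ⁻¹' {n}
  · rw [Set.indicator_of_mem hpn]
    by_contra hne
    refine hp (Finset.mem_antidiagonal.2 ⟨fun h0 => ?_, fun h0 => ?_, hpn⟩)
    · exact hne (by rw [h0]; ring)
    · exact hne (by rw [h0]; ring)
  · exact Set.indicator_of_notMem hpn _

namespace IsLaurentExpansion

variable {L L' : LaurentSeries ℂ} {g g' : ℂ → ℂ}

lemma congr (h : IsLaurentExpansion L g) (hg : g =ᶠ[𝓝[≠] 0] g') : IsLaurentExpansion L g' := by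
  filter_upwards [h, hg] with z hz hgz
  rwa [← hgz]

lemma add (h : IsLaurentExpansion L g) (h' : IsLaurentExpansion L' g') :
    IsLaurentExpansion (L + L') (g + g') := by
  filter_upwards [h, h'] with z hz hz'
  simpa [add_mul] using hz.add hz'

lemma neg (h : IsLaurentExpansion L g) : IsLaurentExpansion (-L) (-g) := by
  filter_upwards [h] with z hz
  simpa using hz.neg

lemma single (n : ℤ) (c : ℂ) :
    IsLaurentExpansion (HahnSeries.single n c) (fun z => c * z ^ n) := by
  refine Filter.Eventually.of_forall fun z => ?_
  have := hasSum_single (f := fun m : ℤ => (HahnSeries.single n c).coeff m * z ^ m) n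
    fun m hm => by simp [HahnSeries.coeff_single_of_ne hm]
  simpa using this

lemma zero : IsLaurentExpansion 0 0 :=
  Filter.Eventually.of_forall fun z => by simp [hasSum_zero]

lemma one : IsLaurentExpansion 1 1 := by
  simpa [Pi.one_def] using single 0 1

/-- The product of two Laurent series converges to the product of their sums: the double series
converges absolutely, and its terms of total degree `n` add up to the coefficient of `z ^ n`. -/
lemma mul (h : IsLaurentExpansion L g) (h' : IsLaurentExpansion L' g') :
    IsLaurentExpansion (L * L') (g * g') := by
  filter_upwards [h, h', self_mem_nhdsWithin] with z hz hz' hz0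
  exact hasSum_mul_of_fiber hz hz' (hasSum_indicator_fiber L L' hz0)

lemma pow (h : IsLaurentExpansion L g) (n : ℕ) : IsLaurentExpansion (L ^ n) (g ^ n) := by
  induction n with
  | zero => simpa using one
  | succ n ih => simpa only [pow_succ] using ih.mul h

lemma sum {ι : Type*} (s : Finset ι) {L : ι → LaurentSeries ℂ} {g : ι → ℂ → ℂ}
    (h : ∀ i ∈ s, IsLaurentExpansion (L i) (g i)) :
    IsLaurentExpansion (∑ i ∈ s, L i) (∑ i ∈ s, g i) := by
  classical
  induction s using Finset.induction_on with
  | empty => simpa using zero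
  | insert a s ha ih =>
    rw [Finset.sum_insert ha, Finset.sum_insert ha]
    exact (h a (by simp)).add (ih fun i hi => h i (by simp [hi]))

lemma prod {ι : Type*} (s : Finset ι) {L : ι → LaurentSeries ℂ} {g : ι → ℂ → ℂ}
    (h : ∀ i ∈ s, IsLaurentExpansion (L i) (g i)) :
    IsLaurentExpansion (∏ i ∈ s, L i) (∏ i ∈ s, g i) := by
  classical
  induction s using Finset.induction_on with
  | empty => simpa using one
  | insert a s ha ih =>
    rw [Finset.prod_insert ha, Finset.prod_insert ha]
    exact (h a (by simp)).mul (ih fun i hi => h i (by simp [hi]))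

lemma of_powerSeries {c : ℕ → ℂ} (h : ∀ᶠ z in 𝓝[≠] (0 : ℂ), HasSum (fun n => c n * z ^ n) (g z)) :
    IsLaurentExpansion ((PowerSeries.mk c : PowerSeries ℂ) : LaurentSeries ℂ) g := by
  filter_upwards [h] with z hz
  rw [← Function.Injective.hasSum_iff (Nat.cast_injective (R := ℤ))]
  · convert hz using 2 with n
    simp [PowerSeries.coeff_coe]
  · intro n hn
    have hneg : n < 0 := by
      by_contra hn0
      exact hn ⟨n.toNat, by simpa using hn0⟩
    simp [PowerSeries.coeff_coe, hneg]

/-- A Laurent series that converges to `0` near the origin is zero: divided by the power of `z` of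
its order, it is a power series whose constant term is nonzero and, by continuity, also zero. -/
lemma eq_zero (h : IsLaurentExpansion L g) (hg : g =ᶠ[𝓝[≠] 0] 0) : L = 0 := by
  classical
  by_contra hL
  set N := L.order with hN
  set c : ℕ → ℂ := fun n => L.coeff (N + n) with hc
  have hc0 : c 0 ≠ 0 := by
    simpa [hc, hN] using HahnSeries.coeff_order_eq_zero.not.2 hL
  have hsum : ∀ᶠ z in 𝓝[≠] (0 : ℂ), HasSum (fun n : ℕ => c n * z ^ n) 0 := by
    filter_upwards [h, hg, self_mem_nhdsWithin] with z hz hgz hz0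
    have hz0 : z ≠ 0 := hz0
    rw [hgz, Pi.zero_apply] at hz
    have hinj : Function.Injective (fun n : ℕ => N + (n : ℤ)) := fun a b hab => by
      simpa using hab
    rw [← hinj.hasSum_iff] at hz
    · have hterm (n : ℕ) : c n * z ^ n = z ^ (-N) * (L.coeff (N + n) * z ^ (N + (n : ℤ))) := by
        rw [zpow_add₀ hz0, zpow_neg, zpow_natCast]
        field_simp
        rfl
      simpa only [hterm, mul_zero, Function.comp_apply] using hz.mul_left (z ^ (-N))
    · intro n hn
      have hlt : n < N := by
        by_contra hlt
        exact hn ⟨(n - N).toNat, by grind⟩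
      simp [HahnSeries.coeff_eq_zero_of_lt_order hlt]
  -- The sum of the power series `c` near `0`, the point `0` included.
  set F : ℂ → ℂ := Function.update 0 0 (c 0) with hF
  have hps : HasFPowerSeriesAt F (FormalMultilinearSeries.ofScalars ℂ c) 0 := by
    rw [hasFPowerSeriesAt_iff]
    rw [eventually_nhdsWithin_iff] at hsum
    filter_upwards [hsum] with z hz
    rcases eq_or_ne z 0 with rfl | hz0
    · have := hasSum_single (f := fun n : ℕ =>
        (0 : ℂ) ^ n • (FormalMultilinearSeries.ofScalars ℂ c).coeff n) 0
        fun n hn => by simp [hn]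
      simpa [hF, FormalMultilinearSeries.coeff_ofScalars] using this
    · have := hz hz0
      simpa [hF, hz0, FormalMultilinearSeries.coeff_ofScalars, mul_comm] using this
  have hlim : Filter.Tendsto F (𝓝[≠] 0) (𝓝 (c 0)) := by
    simpa [hF] using hps.continuousAt.tendsto.mono_left nhdsWithin_le_nhds
  have hlim0 : Filter.Tendsto F (𝓝[≠] 0) (𝓝 0) := by
    refine tendsto_const_nhds.congr' ?_
    filter_upwards [self_mem_nhdsWithin] with z hz
    have hz : z ≠ 0 := hz
    simp [hF, hz]
  exact hc0 (tendsto_nhds_unique hlim hlim0)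

end IsLaurentExpansion

lemma MeromorphicAt.exists_isLaurentExpansion {g : ℂ → ℂ} (hg : MeromorphicAt g 0) :
    ∃ L, IsLaurentExpansion L g := by
  obtain ⟨n, h, ⟨p, hp⟩, hgh⟩ := MeromorphicAt.iff_eventuallyEq_zpow_smul_analyticAt.1 hg
  rw [hasFPowerSeriesAt_iff] at hp
  have hP : IsLaurentExpansion ((PowerSeries.mk p.coeff : PowerSeries ℂ) : LaurentSeries ℂ) h := by
    refine .of_powerSeries ?_
    filter_upwards [hp.filter_mono nhdsWithin_le_nhds] with z hz
    simpa [mul_comm] using hz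
  refine ⟨_, ((IsLaurentExpansion.single n 1).mul hP).congr ?_⟩
  filter_upwards [hgh] with z hz
  simp [hz]

/-- The meromorphic functions on `ℂ` form a field. The expansion of `g⁻¹` is the inverse of the
expansion `L` of `g`, because the product of the two converges to `1`. -/
noncomputable def meromorphicSubfield : Subfield (LaurentSeries ℂ) where
  carrier := meromorphicFunctions
  mul_mem' := by
    rintro _ _ ⟨g, hg, h⟩ ⟨g', hg', h'⟩
    exact ⟨_, hg.mul hg', h.mul h'⟩
  one_mem' := ⟨_, .const 1, .one⟩
  add_mem' := by
    rintro _ _ ⟨g, hg, h⟩ ⟨g', hg', h'⟩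
    exact ⟨_, hg.add hg', h.add h'⟩
  zero_mem' := ⟨_, .const 0, .zero⟩
  neg_mem' := by
    rintro _ ⟨g, hg, h⟩
    exact ⟨_, hg.neg, h.neg⟩
  inv_mem' := by
    rintro L ⟨g, hg, h⟩
    rcases eq_or_ne L 0 with rfl | hL
    · exact ⟨_, .const 0, by rw [inv_zero]; exact .zero⟩
    obtain ⟨L', h'⟩ := (hg.inv 0).exists_isLaurentExpansion
    have hg0 : ∀ᶠ z in 𝓝[≠] (0 : ℂ), g z ≠ 0 :=
      (hg 0).eventually_eq_zero_or_eventually_ne_zero.resolve_left fun h0 => hL (h.eq_zero h0)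
    have hLL' : L * L' + -1 = 0 := by
      refine ((h.mul h').add IsLaurentExpansion.one.neg).eq_zero ?_
      filter_upwards [hg0] with z hz
      simp [hz]
    refine ⟨_, hg.inv, ?_⟩
    rwa [inv_eq_of_mul_eq_one_right (add_neg_eq_zero.1 hLL')]

lemma algebraMap_ratFunc_mem_meromorphicSubfield (r : RatFunc ℂ) :
    algebraMap (RatFunc ℂ) (LaurentSeries ℂ) r ∈ meromorphicSubfield := by
  have hpoly (p : Polynomial ℂ) :
      algebraMap (RatFunc ℂ) (LaurentSeries ℂ) (algebraMap (Polynomial ℂ) (RatFunc ℂ) p) ∈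
        meromorphicSubfield := by
    induction p using Polynomial.induction_on' with
    | add p q hp hq => simpa only [map_add] using add_mem hp hq
    | monomial n a =>
      have hC : (HahnSeries.single 0 a : LaurentSeries ℂ) ∈ meromorphicSubfield :=
        ⟨_, Meromorphic.const a, by simpa using IsLaurentExpansion.single 0 a⟩
      have hX : (HahnSeries.single 1 1 : LaurentSeries ℂ) ∈ meromorphicSubfield :=
        ⟨_, MeromorphicAt.id, by simpa [Function.id_def] using IsLaurentExpansion.single 1 1⟩
      have ha : algebraMap (RatFunc ℂ) (LaurentSeries ℂ)
          (algebraMap (Polynomial ℂ) (RatFunc ℂ) (Polynomial.C a)) = HahnSeries.single 0 a := by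
        simpa using (RatFunc.coe_coe (Polynomial.C a)).symm
      simpa only [← Polynomial.C_mul_X_pow_eq_monomial, map_mul, map_pow, ha, RatFunc.algebraMap_X,
        RatFunc.coe_X] using mul_mem hC (pow_mem hX n)
  obtain ⟨p, q, hq, rfl⟩ := IsFractionRing.div_surjective (A := Polynomial ℂ) r
  rw [map_div₀]
  exact div_mem (hpoly p) (hpoly q)

/-- The field `ℂ(z)(𝓜)` consists of meromorphic functions only. -/
lemma meromorphicField_subset_meromorphicFunctions {L : LaurentSeries ℂ}
    (hL : L ∈ meromorphicField) : L ∈ meromorphicFunctions := by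
  have hle : (meromorphicField.toSubfield : Subfield (LaurentSeries ℂ)) ≤ meromorphicSubfield := by
    rw [meromorphicField, IntermediateField.adjoin_toSubfield]
    refine Subfield.closure_le.2 (Set.union_subset ?_ fun _ h => h)
    rintro _ ⟨r, rfl⟩
    exact algebraMap_ratFunc_mem_meromorphicSubfield r
  exact hle hL

/-! ### Orders of growth at `1` -/

/-- `HasLogOrder φ E`: to the left of `1`, the function `φ` does not vanish and is of the size
`(1 - x) ^ (E + o(1))`. Since `log (1 - x) → -∞`, this is the limit of `log ‖φ x‖ / log (1 - x)`. -/
def HasLogOrder (φ : ℝ → ℂ) (E : ℝ) : Prop :=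
  (∀ᶠ x in 𝓝[<] (1 : ℝ), φ x ≠ 0) ∧
    Filter.Tendsto (fun x => Real.log ‖φ x‖ / Real.log (1 - x)) (𝓝[<] 1) (𝓝 E)

lemma tendsto_one_sub_nhdsLT_one :
    Filter.Tendsto (fun x : ℝ => 1 - x) (𝓝[<] 1) (𝓝[>] 0) := by
  refine tendsto_nhdsWithin_iff.2 ⟨?_, ?_⟩
  · have : Filter.Tendsto (fun x : ℝ => 1 - x) (𝓝 1) (𝓝 (1 - 1)) :=
      (continuous_const.sub continuous_id).tendsto 1
    rw [sub_self] at this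
    exact this.mono_left nhdsWithin_le_nhds
  · filter_upwards [self_mem_nhdsWithin] with x hx
    simpa using hx

lemma tendsto_log_one_sub_nhdsLT_one :
    Filter.Tendsto (fun x : ℝ => Real.log (1 - x)) (𝓝[<] 1) Filter.atBot :=
  Real.tendsto_log_nhdsGT_zero.comp tendsto_one_sub_nhdsLT_one

lemma eventually_log_one_sub_neg : ∀ᶠ x in 𝓝[<] (1 : ℝ), Real.log (1 - x) < 0 :=
  tendsto_log_one_sub_nhdsLT_one.eventually_lt_atBot 0

namespace HasLogOrder

variable {φ ψ : ℝ → ℂ} {E E' : ℝ}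

lemma mul (h : HasLogOrder φ E) (h' : HasLogOrder ψ E') : HasLogOrder (φ * ψ) (E + E') := by
  refine ⟨?_, (h.2.add h'.2).congr' ?_⟩
  · filter_upwards [h.1, h'.1] with x hx hx'
    exact mul_ne_zero hx hx'
  · filter_upwards [h.1, h'.1] with x hx hx'
    rw [Pi.mul_apply, norm_mul, Real.log_mul (norm_ne_zero_iff.2 hx) (norm_ne_zero_iff.2 hx'),
      add_div]

lemma one : HasLogOrder 1 0 :=
  ⟨by simp, by simp⟩

lemma pow (h : HasLogOrder φ E) (n : ℕ) : HasLogOrder (φ ^ n) (n * E) := by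
  induction n with
  | zero => simpa using one
  | succ n ih => simpa [pow_succ, add_mul] using ih.mul h

lemma prod {ι : Type*} (s : Finset ι) {φ : ι → ℝ → ℂ} {E : ι → ℝ}
    (h : ∀ i ∈ s, HasLogOrder (φ i) (E i)) : HasLogOrder (∏ i ∈ s, φ i) (∑ i ∈ s, E i) := by
  classical
  induction s using Finset.induction_on with
  | empty => simpa using one
  | insert a s ha ih =>
    rw [Finset.prod_insert ha, Finset.sum_insert ha]
    exact (h a (by simp)).mul (ih fun i hi => h i (by simp [hi]))

/-- A function between two constant multiples of `(1 - x) ^ E`, up to an arbitrarily small loss in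
the exponent of the upper bound, has order `E`. -/
lemma of_bounds {c : ℝ} (hc : 0 < c)
    (hlow : ∀ᶠ x in 𝓝[<] (1 : ℝ), c * (1 - x) ^ E ≤ ‖φ x‖)
    (hup : ∀ E' < E, ∃ C, 0 < C ∧ ∀ᶠ x in 𝓝[<] (1 : ℝ), ‖φ x‖ ≤ C * (1 - x) ^ E') :
    HasLogOrder φ E := by
  have hlim (C a : ℝ) : Filter.Tendsto (fun x : ℝ => Real.log C / Real.log (1 - x) + a)
      (𝓝[<] 1) (𝓝 a) := by
    simpa using (tendsto_log_one_sub_nhdsLT_one.const_div_atBot (Real.log C)).add_const a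
  have hlogpow {C : ℝ} (hC : 0 < C) (a : ℝ) : ∀ᶠ x in 𝓝[<] (1 : ℝ),
      0 < C * (1 - x) ^ a ∧ Real.log (C * (1 - x) ^ a) / Real.log (1 - x) =
        Real.log C / Real.log (1 - x) + a := by
    filter_upwards [self_mem_nhdsWithin, eventually_log_one_sub_neg] with x hx hlog
    have hx : 0 < 1 - x := sub_pos.2 hx
    have hpos : 0 < (1 - x) ^ a := Real.rpow_pos_of_pos hx a
    refine ⟨mul_pos hC hpos, ?_⟩
    rw [Real.log_mul hC.ne' hpos.ne', Real.log_rpow hx, add_div, mul_div_cancel_right₀ _ hlog.ne]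
  have hne : ∀ᶠ x in 𝓝[<] (1 : ℝ), φ x ≠ 0 := by
    filter_upwards [hlow, hlogpow hc E] with x hx hpos
    exact norm_pos_iff.1 (hpos.1.trans_le hx)
  refine ⟨hne, tendsto_order.2 ⟨fun a ha => ?_, fun a ha => ?_⟩⟩
  · obtain ⟨b, hab, hbE⟩ := exists_between ha
    obtain ⟨C, hC, hCb⟩ := hup b hbE
    filter_upwards [hCb, hlogpow hC b, hne, eventually_log_one_sub_neg,
      (hlim C b).eventually_const_lt hab] with x hx hpow hφ hlog hax
    refine hax.trans_le ?_
    rw [← hpow.2]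
    exact div_le_div_of_nonpos_of_le hlog.le (Real.log_le_log (norm_pos_iff.2 hφ) hx)
  · filter_upwards [hlow, hlogpow hc E, eventually_log_one_sub_neg,
      (hlim c E).eventually_lt_const ha] with x hx hpow hlog hax
    refine lt_of_le_of_lt ?_ hax
    rw [← hpow.2]
    exact div_le_div_of_nonpos_of_le hlog.le (Real.log_le_log hpow.1 hx)

/-- A function of larger order is negligible. -/
lemma isLittleO (h : HasLogOrder φ E) (h' : HasLogOrder ψ E') (hE : E < E') :
    ψ =o[𝓝[<] 1] φ := by
  refine Asymptotics.isLittleO_of_tendsto' (h.1.mono fun x hx h0 => absurd h0 hx) ?_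
  refine tendsto_zero_iff_norm_tendsto_zero.2 ?_
  have hlim : Filter.Tendsto (fun x => Real.exp ((Real.log ‖ψ x‖ / Real.log (1 - x) -
      Real.log ‖φ x‖ / Real.log (1 - x)) * Real.log (1 - x))) (𝓝[<] 1) (𝓝 0) :=
    Real.tendsto_exp_atBot.comp
      ((h'.2.sub h.2).pos_mul_atBot (sub_pos.2 hE) tendsto_log_one_sub_nhdsLT_one)
  refine hlim.congr' ?_
  filter_upwards [h.1, h'.1, eventually_log_one_sub_neg] with x hx hx' hlog
  rw [← sub_div, div_mul_cancel₀ _ hlog.ne, Real.exp_sub, Real.exp_log (norm_pos_iff.2 hx'),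
    Real.exp_log (norm_pos_iff.2 hx), norm_div]

/-- Functions with pairwise distinct orders have a nonvanishing sum: the one of least order
dominates the others. -/
lemma sum_ne_zero {ι : Type*} {s : Finset ι} (hs : s.Nonempty) {φ : ι → ℝ → ℂ} {E : ι → ℝ}
    (h : ∀ i ∈ s, HasLogOrder (φ i) (E i)) (hE : Set.InjOn E s) :
    ∀ᶠ x in 𝓝[<] (1 : ℝ), ∑ i ∈ s, φ i x ≠ 0 := by
  classical
  obtain ⟨i₀, hi₀, hmin⟩ := s.exists_min_image E hs
  have hlittle : (fun x => ∑ i ∈ s.erase i₀, φ i x) =o[𝓝[<] 1] φ i₀ := by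
    simp only [← Finset.sum_apply]
    refine Asymptotics.IsLittleO.sum fun i hi => ?_
    have his := Finset.mem_of_mem_erase hi
    refine (h i₀ hi₀).isLittleO (h i his) ((hmin i his).lt_of_ne fun heq => ?_)
    exact Finset.ne_of_mem_erase hi (hE his hi₀ heq.symm)
  filter_upwards [(h i₀ hi₀).1, hlittle.bound (c := 1 / 2) (by norm_num)] with x hx hb h0
  rw [← Finset.add_sum_erase _ _ hi₀] at h0
  rw [eq_neg_of_add_eq_zero_right h0, norm_neg] at hb
  linarith [norm_pos_iff.2 hx]

end HasLogOrder

/-- The function `x ↦ ↑x` sends punctured left neighbourhoods of real points to punctured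
neighbourhoods in `ℂ`. -/
lemma tendsto_ofReal_nhdsLT (a : ℝ) :
    Filter.Tendsto (fun x : ℝ => (x : ℂ)) (𝓝[<] a) (𝓝[≠] (a : ℂ)) := by
  refine tendsto_nhdsWithin_iff.2 ⟨?_, ?_⟩
  · exact (Complex.continuous_ofReal.tendsto a).mono_left nhdsWithin_le_nhds
  · filter_upwards [self_mem_nhdsWithin] with x hx
    simpa using (ne_of_lt hx)

lemma MeromorphicAt.exists_hasLogOrder {g : ℂ → ℂ} (hg : MeromorphicAt g 1)
    (htop : meromorphicOrderAt g 1 ≠ ⊤) : ∃ n : ℤ, HasLogOrder (fun x => g x) n := by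
  obtain ⟨h, hh, hh1, hgh⟩ := (meromorphicOrderAt_ne_top_iff hg).1 htop
  set n := (meromorphicOrderAt g 1).untop₀
  have htend := tendsto_ofReal_nhdsLT 1
  rw [Complex.ofReal_one] at htend
  have hgh' := htend.eventually hgh
  have hnorm : Filter.Tendsto (fun x : ℝ => ‖h x‖) (𝓝[<] 1) (𝓝 ‖h 1‖) :=
    (hh.continuousAt.tendsto.mono_left nhdsWithin_le_nhds).norm.comp htend
  have hh1 : 0 < ‖h 1‖ := norm_pos_iff.2 hh1
  have heq : ∀ᶠ x : ℝ in 𝓝[<] 1, ‖g x‖ = ‖h x‖ * ((1 - x) ^ (n : ℝ) : ℝ) := by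
    filter_upwards [hgh', self_mem_nhdsWithin] with x hx hx1
    have hx1 : 0 < 1 - x := sub_pos.2 hx1
    rw [hx, smul_eq_mul, norm_mul, norm_zpow, mul_comm, Real.rpow_intCast, norm_sub_rev,
      ← Complex.ofReal_one, ← Complex.ofReal_sub, Complex.norm_real, Real.norm_of_nonneg hx1.le]
  refine ⟨n, HasLogOrder.of_bounds (half_pos hh1) ?_ fun E' hE' => ⟨2 * ‖h 1‖, by positivity, ?_⟩⟩
  · filter_upwards [heq, hnorm.eventually_const_lt (half_lt_self hh1), self_mem_nhdsWithin]
      with x hx hlt hx1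
    have hx1 : 0 < 1 - x := sub_pos.2 hx1
    rw [hx]
    gcongr
  · filter_upwards [heq, hnorm.eventually_lt_const (by linarith : ‖h 1‖ < 2 * ‖h 1‖),
      Ioo_mem_nhdsLT zero_lt_one] with x hx hlt hx1
    have hx0 : 0 < 1 - x := sub_pos.2 hx1.2
    rw [hx]
    gcongr ?_ * ?_
    exact Real.rpow_le_rpow_of_exponent_ge hx0 (by linarith [hx1.1]) hE'.le

/-! ### Power series with coefficient sums of polynomial growth -/

/-- Summation by parts. -/
lemma sum_mul_pow_eq (f : ℕ → ℝ) (x : ℝ) (N : ℕ) :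
    ∑ n ∈ Finset.range (N + 1), f n * x ^ n =
      (1 - x) * ∑ n ∈ Finset.range N, (∑ j ∈ Finset.range (n + 1), f j) * x ^ n +
        (∑ j ∈ Finset.range (N + 1), f j) * x ^ N := by
  induction N with
  | zero => simp
  | succ N ih =>
    rw [Finset.sum_range_succ, ih, Finset.sum_range_succ f (N + 1),
      Finset.sum_range_succ (fun n => (∑ j ∈ Finset.range (n + 1), f j) * x ^ n) N]
    ring

lemma rpow_mul_exp_neg_half_le {γ t : ℝ} (hγ : 0 < γ) (ht : 0 ≤ t) :
    t ^ γ * Real.exp (-(t / 2)) ≤ (2 * γ) ^ γ := by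
  have h1 : t ≤ 2 * γ * Real.exp (t / (2 * γ)) := by
    have h2 : t / (2 * γ) ≤ Real.exp (t / (2 * γ)) := by
      linarith [Real.add_one_le_exp (t / (2 * γ))]
    rw [div_le_iff₀ (by positivity)] at h2
    linarith
  have h3 : t ^ γ ≤ (2 * γ) ^ γ * Real.exp (t / 2) := by
    refine (Real.rpow_le_rpow ht h1 hγ.le).trans_eq ?_
    rw [Real.mul_rpow (by positivity) (Real.exp_pos _).le, ← Real.exp_mul]
    congr 2
    field_simp
  calc t ^ γ * Real.exp (-(t / 2))
      ≤ (2 * γ) ^ γ * Real.exp (t / 2) * Real.exp (-(t / 2)) := by gcongr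
    _ = (2 * γ) ^ γ := by rw [mul_assoc, ← Real.exp_add]; simp

/-- The maximum over `n` of `(n + 1) ^ γ * x ^ (n / 2)` is at most a constant times
`(1 - x) ^ (-γ)`. -/
lemma rpow_mul_sqrt_pow_le {γ x : ℝ} (hγ : 0 < γ) (hx : x ∈ Set.Ioo (0 : ℝ) 1) (n : ℕ) :
    ((n : ℝ) + 1) ^ γ * √x ^ n ≤ (2 * γ) ^ γ * Real.exp (1 / 2) * (1 - x) ^ (-γ) := by
  have hx1 : 0 < 1 - x := sub_pos.2 hx.2
  have hy0 : 0 ≤ √x := Real.sqrt_nonneg x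
  have hsq : √x ^ 2 = x := Real.sq_sqrt hx.1.le
  have hy : √x ≤ Real.exp (-((1 - x) / 2)) := by
    nlinarith [Real.add_one_le_exp (-((1 - x) / 2)), sq_nonneg (√x - 1)]
  have hpow : √x ^ n ≤ Real.exp (-(((n : ℝ) + 1) * (1 - x) / 2)) * Real.exp (1 / 2) := by
    refine (pow_le_pow_left₀ hy0 hy n).trans ?_
    rw [← Real.exp_nat_mul, ← Real.exp_add]
    refine Real.exp_le_exp.2 ?_
    linarith [hx.1]
  have hsplit : ((n : ℝ) + 1) ^ γ = (((n : ℝ) + 1) * (1 - x)) ^ γ * (1 - x) ^ (-γ) := by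
    rw [Real.mul_rpow (by positivity) hx1.le, mul_assoc, ← Real.rpow_add hx1]
    simp
  have hmain := rpow_mul_exp_neg_half_le hγ (t := ((n : ℝ) + 1) * (1 - x)) (by positivity)
  have hpos : 0 ≤ (1 - x) ^ (-γ) := Real.rpow_nonneg hx1.le _
  calc ((n : ℝ) + 1) ^ γ * √x ^ n
      ≤ (((n : ℝ) + 1) * (1 - x)) ^ γ * (1 - x) ^ (-γ) *
          (Real.exp (-(((n : ℝ) + 1) * (1 - x) / 2)) * Real.exp (1 / 2)) := by
        rw [hsplit]; gcongr
    _ = (((n : ℝ) + 1) * (1 - x)) ^ γ * Real.exp (-(((n : ℝ) + 1) * (1 - x) / 2)) *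
          (Real.exp (1 / 2) * (1 - x) ^ (-γ)) := by ring
    _ ≤ (2 * γ) ^ γ * (Real.exp (1 / 2) * (1 - x) ^ (-γ)) := by gcongr
    _ = _ := by ring

/-- If the coefficient sums of `f` are `O(n ^ γ)`, its generating function is `O((1 - x) ^ (-γ))`:
in the summation by parts, `x ^ n` is split into two factors `√x ^ n`, one to absorb `n ^ γ` and
one to sum the geometric series. -/
lemma exists_summable_and_tsum_le {f : ℕ → ℝ} (hf : ∀ n, 0 ≤ f n) {γ C : ℝ} (hγ : 0 < γ)
    (hC : 0 < C) (hS : ∀ n : ℕ, ∑ j ∈ Finset.range (n + 1), f j ≤ C * ((n : ℝ) + 1) ^ γ) :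
    ∃ K, 0 < K ∧ ∀ x ∈ Set.Ioo (0 : ℝ) 1, Summable (fun n => f n * x ^ n) ∧
      ∑' n, f n * x ^ n ≤ K * (1 - x) ^ (-γ) := by
  set B := (2 * γ) ^ γ * Real.exp (1 / 2) with hB
  have hBpos : 0 < B := by positivity
  refine ⟨3 * (C * B), by positivity, fun x hx => ?_⟩
  have hx1 : 0 < 1 - x := sub_pos.2 hx.2
  have hy0 : 0 ≤ √x := Real.sqrt_nonneg x
  have hsq : √x * √x = x := Real.mul_self_sqrt hx.1.le
  have hy1 : √x < 1 := by nlinarith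
  set M := C * B * (1 - x) ^ (-γ) with hM
  have hM0 : 0 ≤ M := by
    have := Real.rpow_nonneg hx1.le (-γ)
    positivity
  have hterm (n : ℕ) : (∑ j ∈ Finset.range (n + 1), f j) * x ^ n ≤ M * √x ^ n := by
    calc (∑ j ∈ Finset.range (n + 1), f j) * x ^ n
        ≤ C * ((n : ℝ) + 1) ^ γ * (√x ^ n * √x ^ n) := by
          rw [← mul_pow, hsq]
          have := hx.1.le
          gcongr
          exact hS n
      _ = C * (((n : ℝ) + 1) ^ γ * √x ^ n) * √x ^ n := by ring
      _ ≤ C * (B * (1 - x) ^ (-γ)) * √x ^ n := by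
          gcongr ?_ * _
          exact mul_le_mul_of_nonneg_left (rpow_mul_sqrt_pow_le hγ hx n) hC.le
      _ = M * √x ^ n := by rw [hM]; ring
  have hgeom (N : ℕ) : (1 - x) * ∑ n ∈ Finset.range N, √x ^ n ≤ 2 := by
    have hg := geom_sum_mul_neg √x N
    have hfac : 1 - x = (1 + √x) * (1 - √x) := by linear_combination hsq
    have hp : 0 ≤ √x ^ N := by positivity
    rw [hfac]
    nlinarith
  have hpartial (N : ℕ) : ∑ n ∈ Finset.range N, f n * x ^ n ≤ 3 * M := by
    have hnn (n : ℕ) : 0 ≤ f n * x ^ n := mul_nonneg (hf n) (pow_nonneg hx.1.le n)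
    refine (Finset.sum_le_sum_of_subset_of_nonneg
      (Finset.range_mono N.le_succ) fun n _ _ => hnn n).trans ?_
    rw [sum_mul_pow_eq]
    have h1 : (1 - x) * ∑ n ∈ Finset.range N, (∑ j ∈ Finset.range (n + 1), f j) * x ^ n ≤
        M * 2 := by
      calc _ ≤ (1 - x) * ∑ n ∈ Finset.range N, M * √x ^ n :=
            mul_le_mul_of_nonneg_left (Finset.sum_le_sum fun n _ => hterm n) hx1.le
        _ = M * ((1 - x) * ∑ n ∈ Finset.range N, √x ^ n) := by rw [← Finset.mul_sum]; ring
        _ ≤ M * 2 := by gcongr; exact hgeom N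
    have h2 : M * √x ^ N ≤ M * 1 := by
      gcongr
      exact pow_le_one₀ hy0 hy1.le
    linarith [hterm N]
  have hnn (n : ℕ) : 0 ≤ f n * x ^ n := mul_nonneg (hf n) (pow_nonneg hx.1.le n)
  refine ⟨summable_of_sum_range_le hnn hpartial, ?_⟩
  refine (Real.tsum_le_of_sum_range_le hnn hpartial).trans_eq ?_
  rw [hM]; ring

/-- If the coefficient sums of `f` are at least `c * n ^ β` for large `n`, its generating function
is at least a constant times `(1 - x) ^ (-β)`: it is enough to look at the first `n ≈ 1 / (1 - x)`
terms, for which `x ^ n` is bounded below. -/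
lemma exists_le_tsum {f : ℕ → ℝ} (hf : ∀ n, 0 ≤ f n) {β c : ℝ} (hβ : 0 ≤ β) (hc : 0 < c)
    (hsum : ∀ x ∈ Set.Ioo (0 : ℝ) 1, Summable fun n => f n * x ^ n)
    (hS : ∀ᶠ n : ℕ in Filter.atTop, c * (n : ℝ) ^ β ≤ ∑ j ∈ Finset.range (n + 1), f j) :
    ∃ c', 0 < c' ∧ ∀ᶠ x in 𝓝[<] (1 : ℝ), c' * (1 - x) ^ (-β) ≤ ∑' n, f n * x ^ n := by
  refine ⟨c * (1 / 2 * Real.exp (-2)), by positivity, ?_⟩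
  have hceil : Filter.Tendsto (fun x : ℝ => ⌈(1 - x)⁻¹⌉₊) (𝓝[<] 1) Filter.atTop :=
    tendsto_nat_ceil_atTop.comp (tendsto_inv_nhdsGT_zero.comp tendsto_one_sub_nhdsLT_one)
  filter_upwards [hceil.eventually hS, Ioo_mem_nhdsLT (by norm_num : (1 / 2 : ℝ) < 1)]
    with x hSx hx
  have hx0 : 0 < x := by linarith [hx.1]
  have hx1 : 0 < 1 - x := sub_pos.2 hx.2
  set N := ⌈(1 - x)⁻¹⌉₊
  have hN : (1 - x)⁻¹ ≤ N := Nat.le_ceil _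
  have hN' : (N : ℝ) < (1 - x)⁻¹ + 1 := Nat.ceil_lt_add_one (by positivity)
  have hxN : 1 / 2 * Real.exp (-2) ≤ x ^ N := by
    have hlog : -(2 * (1 - x)) ≤ Real.log x := by
      have h1 := Real.one_sub_inv_le_log_of_pos hx0
      have h2 : x⁻¹ ≤ 2 := by
        rw [inv_le_comm₀ hx0 two_pos]; linarith [hx.1]
      have h3 : x⁻¹ * x = 1 := inv_mul_cancel₀ hx0.ne'
      nlinarith
    have hlog0 : Real.log x ≤ 0 := Real.log_nonpos hx0.le hx.2.le
    have hexp : x ^ N = Real.exp (N * Real.log x) := by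
      rw [Real.exp_nat_mul, Real.exp_log hx0]
    have hle : -2 + Real.log x ≤ N * Real.log x := by
      have h4 : (1 - x)⁻¹ * (1 - x) = 1 := inv_mul_cancel₀ hx1.ne'
      have h5 : 0 < (1 - x)⁻¹ := by positivity
      nlinarith
    calc 1 / 2 * Real.exp (-2) ≤ x * Real.exp (-2) := by
          gcongr; exact hx.1.le
      _ = Real.exp (-2 + Real.log x) := by rw [Real.exp_add, Real.exp_log hx0, mul_comm]
      _ ≤ x ^ N := by rw [hexp]; exact Real.exp_le_exp.2 hle
  have hpow : (1 - x) ^ (-β) ≤ (N : ℝ) ^ β := by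
    rw [Real.rpow_neg hx1.le, ← Real.inv_rpow hx1.le]
    exact Real.rpow_le_rpow (by positivity) hN hβ
  calc c * (1 / 2 * Real.exp (-2)) * (1 - x) ^ (-β)
      = c * (1 - x) ^ (-β) * (1 / 2 * Real.exp (-2)) := by ring
    _ ≤ c * (N : ℝ) ^ β * x ^ N := by
        have := Real.rpow_nonneg hx1.le (-β)
        gcongr
    _ ≤ (∑ j ∈ Finset.range (N + 1), f j) * x ^ N := by gcongr
    _ ≤ ∑ j ∈ Finset.range (N + 1), f j * x ^ j := by
        rw [Finset.sum_mul]
        refine Finset.sum_le_sum fun j hj => mul_le_mul_of_nonneg_left ?_ (hf j)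
        exact pow_le_pow_of_le_one hx0.le hx.2.le (Nat.lt_succ_iff.1 (Finset.mem_range.1 hj))
    _ ≤ ∑' n, f n * x ^ n :=
        (hsum x ⟨hx0, hx.2⟩).sum_le_tsum _ fun n _ => mul_nonneg (hf n) (pow_nonneg hx0.le n)

namespace IsGrowthConstant

variable {k : ℕ} {f : ℕ → ℤ} {α : ℝ}

lemma exists_lower_bound (h : IsGrowthConstant k f α) (hf : ∀ n, 0 ≤ f n) :
    ∃ c : ℝ, 0 < c ∧ ∀ᶠ N : ℕ in Filter.atTop,
      c * (N : ℝ) ^ Real.logb k α ≤ ∑ n ∈ Finset.range (N + 1), (f n : ℝ) := by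
  obtain ⟨-, m, hm⟩ := h
  obtain ⟨C, hC, hbound⟩ := hm.isBigO_symm.exists_pos
  refine ⟨C⁻¹, by positivity, ?_⟩
  have hlog : ∀ᶠ N : ℕ in Filter.atTop, 1 ≤ Real.log N :=
    (Real.tendsto_log_atTop.comp tendsto_natCast_atTop_atTop).eventually_ge_atTop 1
  filter_upwards [hbound.bound, hlog] with N hN hlogN
  have hS : 0 ≤ ∑ n ∈ Finset.range (N + 1), (f n : ℝ) :=
    Finset.sum_nonneg fun n _ => by exact_mod_cast hf n
  have hpow : 0 ≤ (N : ℝ) ^ Real.logb k α := by positivity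
  rw [Real.norm_of_nonneg hS, Real.norm_of_nonneg (by positivity)] at hN
  rw [inv_mul_le_iff₀ hC]
  exact (le_mul_of_one_le_right hpow (one_le_pow₀ hlogN)).trans hN

lemma exists_upper_bound (h : IsGrowthConstant k f α) {γ : ℝ}
    (hγ : Real.logb k α < γ) (hγ0 : 0 ≤ γ) :
    ∃ C : ℝ, 0 < C ∧ ∀ N : ℕ, ∑ n ∈ Finset.range (N + 1), (f n : ℝ) ≤ C * ((N : ℝ) + 1) ^ γ := by
  obtain ⟨-, m, hm⟩ := h
  have hlog : (fun x : ℝ => Real.log x ^ m) =O[Filter.atTop]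
      fun x : ℝ => x ^ (γ - Real.logb k α) := by
    have := isLittleO_log_rpow_rpow_atTop (m : ℝ) (sub_pos.2 hγ)
    simpa only [Real.rpow_natCast] using this.isBigO
  have hO : (fun N : ℕ => ∑ n ∈ Finset.range (N + 1), (f n : ℝ)) =O[Filter.atTop]
      fun N : ℕ => ((N : ℝ) + 1) ^ γ := by
    refine hm.isBigO.trans (((Asymptotics.isBigO_refl _ _).mul
      (hlog.comp_tendsto tendsto_natCast_atTop_atTop)).trans (.of_bound 1 ?_))
    filter_upwards [Filter.eventually_gt_atTop 0] with N hN
    have hN : (0 : ℝ) < N := by exact_mod_cast hN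
    rw [Function.comp_apply, ← Real.rpow_add hN, add_sub_cancel, one_mul,
      Real.norm_of_nonneg (by positivity), Real.norm_of_nonneg (by positivity)]
    gcongr
    linarith
  obtain ⟨C, hC, hbound⟩ := Asymptotics.bound_of_isBigO_nat_atTop hO
  refine ⟨C, hC, fun N => ?_⟩
  have hpos : 0 < ((N : ℝ) + 1) ^ γ := by positivity
  have := hbound hpos.ne'
  rw [Real.norm_of_nonneg hpos.le] at this
  exact (le_abs_self _).trans this

lemma logb_nonneg (h : IsGrowthConstant k f α) (hk : 2 ≤ k) : 0 ≤ Real.logb k α :=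
  Real.logb_nonneg (by exact_mod_cast hk) h.1

lemma summable (h : IsGrowthConstant k f α) (hk : 2 ≤ k) (hf : ∀ n, 0 ≤ f n) {x : ℝ}
    (hx : x ∈ Set.Ioo (0 : ℝ) 1) : Summable fun n => (f n : ℝ) * x ^ n := by
  have hβ := h.logb_nonneg hk
  obtain ⟨C, hC, hS⟩ := h.exists_upper_bound (lt_add_one _) (by linarith)
  obtain ⟨K, -, hK⟩ := exists_summable_and_tsum_le (fun n => Int.cast_nonneg (hf n))
    (by linarith) hC hS
  exact (hK x hx).1

/-- The generating function of a sequence with growth constant `α` in base `k` has the size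
`(1 - x) ^ (-log_k α + o(1))` as `x → 1⁻`; powers of the logarithm do not affect this order. -/
lemma hasLogOrder (h : IsGrowthConstant k f α) (hk : 2 ≤ k) (hf : ∀ n, 0 ≤ f n) :
    HasLogOrder (fun x => ∑' n, (f n : ℂ) * (x : ℂ) ^ n) (-Real.logb k α) := by
  have hβ := h.logb_nonneg hk
  have hf' (n : ℕ) : (0 : ℝ) ≤ f n := Int.cast_nonneg (hf n)
  have hnorm {x : ℝ} (hx : x ∈ Set.Ioo (0 : ℝ) 1) :
      ‖∑' n, (f n : ℂ) * (x : ℂ) ^ n‖ = ∑' n, (f n : ℝ) * x ^ n := by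
    have : ∑' n, (f n : ℂ) * (x : ℂ) ^ n = ((∑' n, (f n : ℝ) * x ^ n : ℝ) : ℂ) := by
      push_cast
      rfl
    rw [this, Complex.norm_real, Real.norm_of_nonneg]
    exact tsum_nonneg fun n => mul_nonneg (hf' n) (pow_nonneg hx.1.le n)
  have hIoo : Set.Ioo (0 : ℝ) 1 ∈ 𝓝[<] (1 : ℝ) := Ioo_mem_nhdsLT zero_lt_one
  obtain ⟨c, hc, hS⟩ := h.exists_lower_bound hf
  obtain ⟨c', hc', hlow⟩ := exists_le_tsum hf' hβ hc (fun x hx => h.summable hk hf hx) hS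
  refine HasLogOrder.of_bounds hc' ?_ fun E' hE' => ?_
  · filter_upwards [hlow, hIoo] with x hx hx01
    rwa [hnorm hx01]
  · obtain ⟨C, hC, hS⟩ := h.exists_upper_bound (γ := -E') (by linarith) (by linarith)
    obtain ⟨K, hK, hup⟩ := exists_summable_and_tsum_le hf' (by linarith) hC hS
    refine ⟨K, hK, ?_⟩
    filter_upwards [hIoo] with x hx
    rw [hnorm hx]
    simpa using (hup x hx).2

/-- The generating function converges, and is analytic, on the unit disc. -/
lemma hasFPowerSeriesOnBall (h : IsGrowthConstant k f α) (hk : 2 ≤ k) (hf : ∀ n, 0 ≤ f n) :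
    HasFPowerSeriesOnBall (fun z : ℂ => ∑' n, (f n : ℂ) * z ^ n)
      (FormalMultilinearSeries.ofScalars ℂ fun n => (f n : ℂ)) 0 1 := by
  have hrad : 1 ≤ (FormalMultilinearSeries.ofScalars ℂ fun n => (f n : ℂ)).radius := by
    refine ENNReal.le_of_forall_nnreal_lt fun r hr => ?_
    rcases eq_or_ne r 0 with rfl | hr0
    · simp
    refine FormalMultilinearSeries.le_radius_of_summable_norm _ ?_
    have hr1 : (r : ℝ) < 1 := by exact_mod_cast hr
    have hs := h.summable hk hf (x := r) ⟨by positivity, hr1⟩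
    convert hs using 2 with n
    rw [FormalMultilinearSeries.ofScalars_norm, Complex.norm_intCast,
      abs_of_nonneg (Int.cast_nonneg (hf n))]
  have hsum : (FormalMultilinearSeries.ofScalars ℂ fun n => (f n : ℂ)).sum =
      fun z : ℂ => ∑' n, (f n : ℂ) * z ^ n := by
    funext z
    exact FormalMultilinearSeries.ofScalars_sum_eq _ z
  rw [← hsum]
  exact (FormalMultilinearSeries.hasFPowerSeriesOnBall _ (zero_lt_one.trans_le hrad)).mono
    zero_lt_one hrad

end IsGrowthConstant

/-! ### Algebraic independence -/

lemma IsGrowthConstant.isLaurentExpansion {k : ℕ} {f : ℕ → ℤ} {α : ℝ} (h : IsGrowthConstant k f α)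
    (hk : 2 ≤ k) (hf : ∀ n, 0 ≤ f n) :
    IsLaurentExpansion (generatingFunction f) fun z => ∑' n, (f n : ℂ) * z ^ n := by
  refine .of_powerSeries (Filter.Eventually.filter_mono nhdsWithin_le_nhds ?_)
  have hps := (h.hasFPowerSeriesOnBall hk hf).hasFPowerSeriesAt
  filter_upwards [hasFPowerSeriesAt_iff.1 hps] with z hz
  simpa [FormalMultilinearSeries.coeff_ofScalars, mul_comm] using hz

/-- Multiplicative independence of `k` and the `α i`, in additive form: the numbers `log_k (α i)`
are linearly independent over `ℚ` modulo `ℚ`. -/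
lemma MultiplicativelyIndependent.eq_zero_of_logb {k d : ℕ} (hk : 2 ≤ k) {α : Fin d → ℝ}
    (hα : ∀ i, 0 < α i) (h : MultiplicativelyIndependent (Fin.cons (k : ℝ) α : Fin (d + 1) → ℝ))
    {m : ℤ} {e : Fin d → ℤ} (he : (m : ℝ) + ∑ i, e i * Real.logb k (α i) = 0) : e = 0 := by
  have hk0 : (0 : ℝ) < k := by positivity
  have hlog : Real.log k ≠ 0 := (Real.log_pos (by exact_mod_cast hk)).ne'
  have hprod : (k : ℝ) ^ m * ∏ i, α i ^ e i = 1 := by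
    refine Real.eq_one_of_pos_of_log_eq_zero
      (mul_pos (zpow_pos hk0 m) (Finset.prod_pos fun i _ => zpow_pos (hα i) _)) ?_
    rw [Real.log_mul (zpow_pos hk0 m).ne' (Finset.prod_pos fun i _ => zpow_pos (hα i) _).ne',
      Real.log_prod fun i _ => (zpow_pos (hα i) _).ne']
    have hmul : ((m : ℝ) + ∑ i, e i * Real.logb k (α i)) * Real.log k = 0 := by
      rw [he, zero_mul]
    rw [add_mul, Finset.sum_mul] at hmul
    simpa [Real.log_zpow, mul_assoc, Real.logb, hlog] using hmul
  have := h (Fin.cons m e) (by simpa [Fin.prod_univ_succ] using hprod)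
  funext i
  simpa using this i.succ

/-- A meromorphic function on the unit disc that vanishes near `0` vanishes at points of the real
axis arbitrarily close to `1`. -/
lemma frequently_eq_zero_of_meromorphicOn {H : ℂ → ℂ} (hH : MeromorphicOn H (Metric.ball 0 1))
    (h0 : H =ᶠ[𝓝[≠] 0] 0) : ∃ᶠ x : ℝ in 𝓝[<] 1, H x = 0 := by
  intro hne
  obtain ⟨a, ha, hsub⟩ := (mem_nhdsLT_iff_exists_Ioo_subset' zero_lt_one).1 hne
  obtain ⟨y, hy1, hy2⟩ := exists_between (max_lt (show a < 1 from ha) zero_lt_one)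
  have hy0 : 0 < y := (le_max_right _ _).trans_lt hy1
  have htop : meromorphicOrderAt H y = ⊤ := by
    by_contra hfin
    refine hH.meromorphicOrderAt_ne_top_of_isPreconnected
      (convex_ball (0 : ℂ) 1).isPreconnected ?_ (Metric.mem_ball_self zero_lt_one) hfin
      (meromorphicOrderAt_eq_top_iff.2 h0)
    simpa [abs_of_pos hy0] using hy2
  have hzero := (tendsto_ofReal_nhdsLT y).eventually (meromorphicOrderAt_eq_top_iff.1 htop)
  obtain ⟨x, hx0, hx⟩ := (hzero.and
    (Ioo_mem_nhdsLT ((le_max_left _ _).trans_lt hy1))).exists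
  exact hsub ⟨hx.1, hx.2.trans hy2⟩ hx0

/-- The order at `1` of a monomial of exponent `j` with a meromorphic coefficient is an integer minus
`∑ j i * log_k (α i)`. By multiplicative independence, distinct monomials have distinct orders, so
that no nontrivial relation is possible. -/
theorem algebraicIndependent_generatingFunction {k : ℕ} (hk : 2 ≤ k) {d : ℕ} {f : Fin d → ℕ → ℤ}
    (hf : ∀ i n, 0 ≤ f i n) {α : Fin d → ℝ} (hα : ∀ i, IsGrowthConstant k (f i) (α i))
    (hindep : MultiplicativelyIndependent (Fin.cons (k : ℝ) α : Fin (d + 1) → ℝ)) :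
    AlgebraicIndependent meromorphicField (fun i => generatingFunction (f i)) := by
  rw [algebraicIndependent_iff]
  intro p hp
  by_contra hp0
  have hcoeff (j : Fin d →₀ ℕ) : ∃ g : ℂ → ℂ, Meromorphic g ∧
      IsLaurentExpansion ((MvPolynomial.coeff j p : meromorphicField) : LaurentSeries ℂ) g :=
    meromorphicField_subset_meromorphicFunctions (p.coeff j).2
  choose g hg hexp using hcoeff
  have horder (j : Fin d →₀ ℕ) : ∃ n : ℤ, j ∈ p.support → HasLogOrder (fun x => g j x) n := by
    by_cases hj : j ∈ p.support
    · have htop : meromorphicOrderAt (g j) 0 ≠ ⊤ := fun htop =>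
        MvPolynomial.mem_support_iff.1 hj
          (Subtype.ext ((hexp j).eq_zero (meromorphicOrderAt_eq_top_iff.1 htop)))
      obtain ⟨n, hn⟩ := (hg j 1).exists_hasLogOrder
        ((hg j).meromorphicOn.meromorphicOrderAt_ne_top_of_isPreconnected
          isPreconnected_univ (Set.mem_univ 0) (Set.mem_univ 1) htop)
      exact ⟨n, fun _ => hn⟩
    · exact ⟨0, fun h => absurd h hj⟩
  choose n hn using horder
  set F : Fin d → ℂ → ℂ := fun i z => ∑' m, (f i m : ℂ) * z ^ m
  set H : ℂ → ℂ := ∑ j ∈ p.support, g j * ∏ i, F i ^ j i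
  have hH0 : H =ᶠ[𝓝[≠] 0] 0 := by
    have hexpH : IsLaurentExpansion
        (∑ j ∈ p.support, ((MvPolynomial.coeff j p : meromorphicField) : LaurentSeries ℂ) *
          ∏ i, generatingFunction (f i) ^ j i) H :=
      .sum _ fun j _ => (hexp j).mul
        (.prod _ fun i _ => ((hα i).isLaurentExpansion hk (hf i)).pow (j i))
    have hrel : ∑ j ∈ p.support,
        ((MvPolynomial.coeff j p : meromorphicField) : LaurentSeries ℂ) *
          ∏ i, generatingFunction (f i) ^ j i = 0 := by
      rw [← hp, MvPolynomial.aeval_def, MvPolynomial.eval₂_eq']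
      rfl
    rw [hrel] at hexpH
    filter_upwards [hexpH] with z hz
    exact hz.unique (by simp [hasSum_zero])
  have hHmer : MeromorphicOn H (Metric.ball 0 1) := by
    refine MeromorphicOn.sum fun j _ => (hg j).meromorphicOn.mul (MeromorphicOn.prod fun i _ => ?_)
    intro z hz
    refine (AnalyticAt.meromorphicAt ?_).pow _
    exact ((hα i).hasFPowerSeriesOnBall hk (hf i)).analyticAt_of_mem (by
      rwa [← ENNReal.ofReal_one, Metric.eball_ofReal])
  have hterm (j : Fin d →₀ ℕ) (hj : j ∈ p.support) :
      HasLogOrder ((fun x : ℝ => g j x) * ∏ i, (fun x : ℝ => F i x) ^ j i)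
        (n j + ∑ i, (j i : ℝ) * -Real.logb k (α i)) :=
    (hn j hj).mul (.prod _ fun i _ => ((hα i).hasLogOrder hk (hf i)).pow (j i))
  have hinj : Set.InjOn (fun j : Fin d →₀ ℕ => (n j : ℝ) + ∑ i, (j i : ℝ) * -Real.logb k (α i))
      p.support := by
    intro j _ l _ hjl
    have hdiff := hindep.eq_zero_of_logb hk (fun i => zero_lt_one.trans_le (hα i).1)
      (m := n l - n j) (e := fun i => (j i : ℤ) - l i) (by
        simp only [mul_neg, Finset.sum_neg_distrib] at hjl
        push_cast
        simp only [sub_mul, Finset.sum_sub_distrib]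
        linarith)
    ext i
    have := congrFun hdiff i
    simp only [Pi.zero_apply] at this
    omega
  refine frequently_eq_zero_of_meromorphicOn hHmer hH0 ?_
  filter_upwards [HasLogOrder.sum_ne_zero (MvPolynomial.support_nonempty.2 hp0) hterm hinj]
    with x hx
  simpa [H] using hx

/-- The field generated by `x` is algebraic over the algebra generated by `x`, which is a polynomial
ring. -/
lemma AlgebraicIndependent.trdeg_adjoin_range {K L : Type*} [Field K] [Field L] [Algebra K L]
    {d : ℕ} {x : Fin d → L} (hx : AlgebraicIndependent K x) :
    Algebra.trdeg K (IntermediateField.adjoin K (Set.range x)) = d := by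
  open scoped IntermediateField.algebraAdjoinAdjoin in
  rw [← trdeg_add_eq K (Algebra.adjoin K (Set.range x)),
    trdeg_eq_zero (R := Algebra.adjoin K (Set.range x)), add_zero]
  have := hx.aevalEquiv.lift_trdeg_eq
  rw [MvPolynomial.trdeg_of_isDomain] at this
  simpa using this.symm

theorem theorem3 (k : ℕ) (hk : 2 ≤ k) (d : ℕ) (f : Fin d → ℕ → ℤ)
    (hf_nonneg : ∀ i n, 0 ≤ f i n) (hf_regular : ∀ i, IsRegularSeq k (f i))
    (α : Fin d → ℝ) (hα : ∀ i, IsGrowthConstant k (f i) (α i))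
    (hindep : MultiplicativelyIndependent (Fin.cons (k : ℝ) α : Fin (d + 1) → ℝ)) :
    Algebra.trdeg meromorphicField
        (IntermediateField.adjoin meromorphicField
          (Set.range fun i => generatingFunction (f i))) = (d : Cardinal) ∧
      AlgebraicIndependent meromorphicField (fun i => generatingFunction (f i)) ∧
      AlgebraicIndependent (RatFunc ℂ) (fun i => generatingFunction (f i)) := by
  have h := algebraicIndependent_generatingFunction hk hf_nonneg hα hindep
  exact ⟨h.trdeg_adjoin_range, h,
    h.restrictScalars (algebraMap (RatFunc ℂ) meromorphicField).injective⟩
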